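/- Let $K\subset[0,1]$ be the triadic (middle-thirds) Cantor set, let $\gamma=\log_3 2$ be its Hausdorff dimension, and let $\mu$ be the standard Cantor probability measure on $K$, i.e. the distribution of $\sum_{n\ge 1}\varepsilon_n 3^{-n}$, where the $\varepsilon_n$ are independent and take the values $0$ and $2$ with probability $1/2$ each. Let $\psi:(0,\infty)\to(0,\infty)$ be non-increasing, and suppose that $$\sum_{n\ge 1} n\,\bigl(3^n\psi(3^n)\bigr)^{\gamma}=\infty .$$ Then $$\mu\Bigl(\Bigl\{x\in K:\ \Bigl|x-\frac pq\Bigr|<\psi(q)\ \text{ for infinitely many rational numbers } \frac pq\in K\Bigr\}\Bigr)=1,$$ where each rational number $p/q$ is written in lowest terms with $q\ge 1$. That is, $\mu$-almost every point of $K$ is intrinsically $\psi$-well approximable. -/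

import Mathlib

open MeasureTheory

/-- The point `∑ₙ εₙ / 3 ^ (n + 1)` (`n ≥ 0`) of the triadic Cantor set whose ternary digits `εₙ` are
`2` where `ω` is `true` and `0` where `ω` is `false`. -/
noncomputable def cantorPoint (ω : ℕ → Bool) : ℝ :=
  Real.ofDigits (b := 3) fun n => bif ω n then 2 else 0

/-- The standard Cantor measure: the law of a random point of the triadic Cantor set whose
ternary digits are independent and take the values `0` and `2` with probability `1 / 2` each. -/
noncomputable def cantorMeasure : Measure ℝ :=
  (Measure.infinitePi fun _ : ℕ => (PMF.uniformOfFintype Bool).toMeasure).map cantorPoint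

/-- The map pushed forward in `cantorMeasure` is measurable, so the pushforward is genuine. -/
theorem measurable_cantorPoint : Measurable cantorPoint := by
  have h : Continuous cantorPoint := by
    refine Real.continuous_ofDigits.comp (continuous_pi fun n => ?_)
    exact (continuous_of_discreteTopology (f := fun c : Bool => (bif c then 2 else 0 : Fin 3))).comp
      (continuous_apply n)
  exact h.measurable

instance isProbabilityMeasure_cantorMeasure : IsProbabilityMeasure cantorMeasure :=
  Measure.isProbabilityMeasure_map measurable_cantorPoint.aemeasurable

/-- The points `x` of `C` that are intrinsically `ψ`-well approximable: there are infinitely many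
rational numbers `r = p / q` in `C`, where `q` is the denominator of `r` in lowest terms, such
that `|x - p / q| < ψ q`. -/
def intrinsicallyApproximable (C : Set ℝ) (ψ : ℝ → ℝ) : Set ℝ :=
  {x | x ∈ C ∧ {r : ℚ | (r : ℝ) ∈ C ∧ |x - (r : ℝ)| < ψ (r.den : ℝ)}.Infinite}

/-! If the block of `l` digits of `ω` at `n` repeats the one at an earlier `m`, continuing the first
`n` digits with period `n - m` gives a rational point of the Cantor set with denominator at most `3
^ n` and within `3 ^ (-(n + l))` of the given point (`exists_rat_eq_cantorPoint_periodize`,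
`periodize_eq_of_mem_blockMatch`). With `l = l n` least such that `3 ^ (-(n + l)) < ψ (3 ^ n)`, this
approximates well enough, as `ψ` is non-increasing.

A match has probability `2 ^ (-l n)`, which is at least half of `(3 ^ n * ψ (3 ^ n)) ^ γ` when `l n
≠ 0`, and about `n / 2` values of `m` are available. So the hypothesis makes the expected number of
matches infinite; this is the source of the factor `n`. Matches are pairwise independent except for
overlapping ones of equal shift `n - m`, whose correlations sum geometrically, so the second moment
method gives matches for arbitrarily large `n` (`ae_exists_blockMatch`). -/

/-! ### Independence of equations between coins -/

/-- The law of a sequence of independent fair coin tosses. -/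
noncomputable abbrev coinMeasure : Measure (ℕ → Bool) :=
  Measure.infinitePi fun _ : ℕ => (PMF.uniformOfFintype Bool).toMeasure

/-- Flipping the coin number `v`. -/
def flipAt (v : ℕ) (ω : ℕ → Bool) : ℕ → Bool :=
  fun i => if i = v then !(ω i) else ω i

theorem map_not_uniformOfFintype :
    ((PMF.uniformOfFintype Bool).toMeasure).map not = (PMF.uniformOfFintype Bool).toMeasure := by
  ext s hs
  rw [Measure.map_apply (measurable_of_finite _) hs]
  classical
  rw [PMF.toMeasure_uniformOfFintype_apply _ hs,
    PMF.toMeasure_uniformOfFintype_apply _ (measurable_of_finite not hs)]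
  congr 2
  refine Fintype.card_congr ⟨fun x => ⟨!x.1, x.2⟩, fun x => ⟨!x.1, by simp⟩, ?_, ?_⟩
  · intro x; simp
  · intro x; simp

theorem measurePreserving_flipAt (v : ℕ) :
    MeasurePreserving (flipAt v) coinMeasure coinMeasure := by
  have hf : ∀ i, Measurable (fun b : Bool => if i = v then !b else b) :=
    fun i => measurable_of_finite _
  refine ⟨?_, ?_⟩
  · exact measurable_pi_lambda _ fun i => (hf i).comp (measurable_pi_apply i)
  · have h := Measure.infinitePi_map_pi
      (μ := fun _ : ℕ => (PMF.uniformOfFintype Bool).toMeasure) hf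
    have e : (fun i => ((PMF.uniformOfFintype Bool).toMeasure).map
        (fun b : Bool => if i = v then !b else b)) =
        fun _ : ℕ => (PMF.uniformOfFintype Bool).toMeasure := by
      funext i
      by_cases hi : i = v
      · simpa [hi] using map_not_uniformOfFintype
      · simp [hi]
    simp only [e] at h
    exact h

/-- The sequences whose values agree at the two ends of every edge in `s`. -/
def agreeOn (s : Finset (ℕ × ℕ)) : Set (ℕ → Bool) :=
  {ω | ∀ e ∈ s, ω e.1 = ω e.2}

theorem measurableSet_agreeOn (s : Finset (ℕ × ℕ)) : MeasurableSet (agreeOn s) := by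
  have : agreeOn s = ⋂ e ∈ s, {ω | ω e.1 = ω e.2} := by
    ext ω; simp [agreeOn]
  rw [this]
  exact Finset.measurableSet_biInter _ fun e _ =>
    measurableSet_eq_fun (measurable_pi_apply _) (measurable_pi_apply _)

theorem agreeOn_union (s t : Finset (ℕ × ℕ)) : agreeOn (s ∪ t) = agreeOn s ∩ agreeOn t := by
  ext ω
  simp only [agreeOn, Finset.mem_union, Set.mem_ofPred_eq, Set.mem_inter_iff]
  exact ⟨fun h => ⟨fun e he => h e (.inl he), fun e he => h e (.inr he)⟩,
    fun h e he => he.elim (h.1 e) (h.2 e)⟩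

/-- Flipping coin `v` preserves `G` and the measure but exchanges `ω a = ω b` with its negation, so
it swaps two halves of `G`. -/
theorem measureReal_inter_eq_half {G : Set (ℕ → Bool)} (hG : MeasurableSet G) {v a b : ℕ}
    (hinv : flipAt v ⁻¹' G = G) (hab : a ≠ b) (hv : v = a ∨ v = b) :
    coinMeasure.real ({ω | ω a = ω b} ∩ G) = 1 / 2 * coinMeasure.real G := by
  have hE : MeasurableSet {ω : ℕ → Bool | ω a = ω b} :=
    measurableSet_eq_fun (measurable_pi_apply _) (measurable_pi_apply _)
  have hpre : flipAt v ⁻¹' (G ∩ {ω | ω a = ω b}) = G \ {ω | ω a = ω b} := by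
    rw [Set.preimage_inter, hinv, Set.sdiff_eq]
    congr 1
    ext ω
    rcases hv with rfl | rfl
    · cases h₁ : ω v <;> cases h₂ : ω b <;> simp [flipAt, hab.symm, h₁, h₂]
    · cases h₁ : ω a <;> cases h₂ : ω v <;> simp [flipAt, hab, h₁, h₂]
  have h1 : coinMeasure.real (G \ {ω | ω a = ω b}) = coinMeasure.real (G ∩ {ω | ω a = ω b}) := by
    rw [← hpre]
    exact (measurePreserving_flipAt v).measureReal_preimage (hG.inter hE).nullMeasurableSet
  have h2 := measureReal_inter_add_sdiff (μ := coinMeasure) (s := G) hE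
  rw [Set.inter_comm]
  linarith

/-- If the edges of `s` can be ordered by a key so that each has an end, its pivot, that lies on no
edge with a smaller or equal key, then the corresponding equations are independent. -/
theorem measureReal_agreeOn {s : Finset (ℕ × ℕ)} (key : ℕ × ℕ → ℤ) (pivot : ℕ × ℕ → ℕ)
    (hne : ∀ e ∈ s, e.1 ≠ e.2) (hpiv : ∀ e ∈ s, pivot e = e.1 ∨ pivot e = e.2)
    (hnew : ∀ e ∈ s, ∀ e' ∈ s, e' ≠ e → key e' ≤ key e → pivot e ≠ e'.1 ∧ pivot e ≠ e'.2) :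
    coinMeasure.real (agreeOn s) = (1 / 2) ^ s.card := by
  induction s using Finset.induction_on_max_value key with
  | empty => simp [agreeOn]
  | insert a s ha hmax ih =>
    have hset : agreeOn (insert a s) = {ω | ω a.1 = ω a.2} ∩ agreeOn s := by
      ext ω; simp [agreeOn]
    rw [hset, measureReal_inter_eq_half (v := pivot a) (measurableSet_agreeOn s) ?_
      (hne a (Finset.mem_insert_self _ _)) (hpiv a (Finset.mem_insert_self _ _)),
      ih (fun e he => hne e (Finset.mem_insert_of_mem he))
        (fun e he => hpiv e (Finset.mem_insert_of_mem he))
        (fun e he e' he' => hnew e (Finset.mem_insert_of_mem he) e' (Finset.mem_insert_of_mem he')),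
      Finset.card_insert_of_notMem ha, pow_succ, mul_comm]
    ext ω
    simp only [agreeOn, Set.mem_preimage, Set.mem_ofPred_eq]
    refine forall₂_congr fun e he => ?_
    obtain ⟨h1, h2⟩ := hnew a (Finset.mem_insert_self _ _) e (Finset.mem_insert_of_mem he)
      (fun h => ha (h ▸ he)) (hmax e he)
    simp [flipAt, h1.symm, h2.symm]

/-! ### Block matches and their pairwise correlations -/

/-- The edges joining corresponding positions of the blocks of length `l` at `n` and at `m`. -/
def blockEdges (n m l : ℕ) : Finset (ℕ × ℕ) :=
  (Finset.range l).image fun i => (n + i, m + i)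

theorem mem_blockEdges {n m l : ℕ} {e : ℕ × ℕ} :
    e ∈ blockEdges n m l ↔ ∃ i < l, e = (n + i, m + i) := by
  simp [blockEdges, eq_comm]

theorem card_blockEdges (n m l : ℕ) : (blockEdges n m l).card = l := by
  rw [blockEdges, Finset.card_image_of_injective, Finset.card_range]
  intro i j h
  simpa using congrArg Prod.fst h

/-- The event that the blocks of length `l` at `n` and at `m` are equal. -/
def blockMatch (n m l : ℕ) : Set (ℕ → Bool) := agreeOn (blockEdges n m l)

theorem mem_blockMatch {n m l : ℕ} {ω : ℕ → Bool} :
    ω ∈ blockMatch n m l ↔ ∀ i < l, ω (n + i) = ω (m + i) := by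
  simp [blockMatch, agreeOn, blockEdges]

theorem measurableSet_blockMatch (n m l : ℕ) : MeasurableSet (blockMatch n m l) :=
  measurableSet_agreeOn _

theorem measureReal_blockMatch {n m : ℕ} (l : ℕ) (h : m < n) :
    coinMeasure.real (blockMatch n m l) = (1 / 2) ^ l := by
  have := measureReal_agreeOn (s := blockEdges n m l) (fun e => e.1) (fun e => e.1)
    (by simp only [mem_blockEdges]; rintro _ ⟨i, hi, rfl⟩; dsimp only; omega)
    (fun e _ => .inl rfl)
    (by
      simp only [mem_blockEdges]
      rintro _ ⟨i, hi, rfl⟩ _ ⟨j, hj, rfl⟩ hij hle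
      simp only [ne_eq, Prod.mk.injEq, not_and] at hij hle ⊢
      omega)
  rwa [card_blockEdges] at this

theorem measureReal_blockMatch_inter_of_disjoint {n m l n' m' l' : ℕ} (h : m < n) (h' : m' < n')
    (hd : n + l ≤ n') :
    coinMeasure.real (blockMatch n m l ∩ blockMatch n' m' l') = (1 / 2) ^ l * (1 / 2) ^ l' := by
  have hdisj : Disjoint (blockEdges n m l) (blockEdges n' m' l') := by
    rw [Finset.disjoint_left]
    simp only [mem_blockEdges]
    rintro _ ⟨i, hi, rfl⟩ ⟨j, hj, hij⟩
    simp only [Prod.mk.injEq] at hij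
    omega
  have := measureReal_agreeOn (s := blockEdges n m l ∪ blockEdges n' m' l')
    (fun e => e.1) (fun e => e.1)
    (by simp only [Finset.mem_union, mem_blockEdges]
        rintro _ (⟨i, hi, rfl⟩ | ⟨i, hi, rfl⟩) <;> dsimp only <;> omega)
    (fun e _ => .inl rfl)
    (by
      simp only [Finset.mem_union, mem_blockEdges]
      rintro _ (⟨i, hi, rfl⟩ | ⟨i, hi, rfl⟩) _ (⟨j, hj, rfl⟩ | ⟨j, hj, rfl⟩) hij hle <;>
      simp only [ne_eq, Prod.mk.injEq, not_and] at hij hle ⊢ <;>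
      omega)
  rwa [Finset.card_union_of_disjoint hdisj, card_blockEdges, card_blockEdges, agreeOn_union,
    pow_add] at this

/-- Take edges by decreasing upper end, the smaller shift first in a tie. A smaller-shift edge
brings in a new upper end. A larger-shift edge brings in a new lower end, since it reaches further
down than every edge before it. -/
theorem measureReal_blockMatch_inter_of_lt {n m l n' m' l' : ℕ}
    (h₁ : m + l ≤ n) (h₂ : m' + l' ≤ n) (h₃ : m < n) (h₄ : m' < n') (hlt : n + m' < n' + m) :
    coinMeasure.real (blockMatch n m l ∩ blockMatch n' m' l') = (1 / 2) ^ l * (1 / 2) ^ l' := by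
  have hdisj : Disjoint (blockEdges n m l) (blockEdges n' m' l') := by
    rw [Finset.disjoint_left]
    simp only [mem_blockEdges]
    rintro _ ⟨i, hi, rfl⟩ ⟨j, hj, hij⟩
    simp only [Prod.mk.injEq] at hij
    omega
  have := measureReal_agreeOn (s := blockEdges n m l ∪ blockEdges n' m' l')
    (fun e => -2 * e.1 + if e.1 + m = e.2 + n then 0 else 1)
    (fun e => if e.1 + m = e.2 + n then e.1 else e.2)
    (by simp only [Finset.mem_union, mem_blockEdges]
        rintro _ (⟨i, hi, rfl⟩ | ⟨i, hi, rfl⟩) <;> dsimp only <;> omega)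
    (by intro e _; split_ifs <;> simp)
    (by
      simp only [Finset.mem_union, mem_blockEdges]
      rintro _ (⟨i, hi, rfl⟩ | ⟨i, hi, rfl⟩) _ (⟨j, hj, rfl⟩ | ⟨j, hj, rfl⟩) hij hle <;>
      simp only [ne_eq, Prod.mk.injEq, not_and] at hij hle ⊢ <;>
      split_ifs at hle ⊢ <;>
      omega)
  rwa [Finset.card_union_of_disjoint hdisj, card_blockEdges, card_blockEdges, agreeOn_union,
    pow_add] at this

theorem measureReal_blockMatch_inter_of_ne {n m l n' m' l' : ℕ}
    (h₁ : m + l ≤ n) (h₂ : m + l ≤ n') (h₃ : m' + l' ≤ n) (h₄ : m' + l' ≤ n')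
    (h₅ : m < n) (h₆ : m' < n') (hne : n + m' ≠ n' + m) :
    coinMeasure.real (blockMatch n m l ∩ blockMatch n' m' l') = (1 / 2) ^ l * (1 / 2) ^ l' := by
  rcases hne.lt_or_gt with h | h
  · exact measureReal_blockMatch_inter_of_lt h₁ h₃ h₅ h₆ h
  · rw [Set.inter_comm, mul_comm]
    exact measureReal_blockMatch_inter_of_lt h₄ h₂ h₆ h₅ h

/-- For equal shifts the two overlapping matches merge into a single match of length `(n' - n) + l'`
starting at `n` and `m`. -/
theorem measureReal_blockMatch_inter_le {n m l n' m' l' : ℕ} (h : m < n) (hn : n ≤ n')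
    (hl : n' ≤ n + l) (heq : n + m' = n' + m) :
    coinMeasure.real (blockMatch n m l ∩ blockMatch n' m' l') ≤
      (1 / 2) ^ (n' - n) * (1 / 2) ^ l' := by
  rw [← pow_add, ← measureReal_blockMatch _ h]
  refine measureReal_mono fun ω hω => ?_
  simp only [Set.mem_inter_iff, mem_blockMatch] at hω ⊢
  intro i hi
  by_cases hil : i < l
  · exact hω.1 i hil
  · have := hω.2 (i - (n' - n)) (by omega)
    rwa [show n' + (i - (n' - n)) = n + i by omega,
      show m' + (i - (n' - n)) = m + i by omega] at this

theorem coinMeasure_singleton (ω : ℕ → Bool) : coinMeasure {ω} = 0 := by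
  refine le_antisymm (ge_of_tendsto' (ENNReal.tendsto_pow_atTop_nhds_zero_of_lt_one
    (r := 2⁻¹) (by simp)) fun n => ?_) zero_le
  have h : coinMeasure ((Finset.range n : Set ℕ).pi fun i => {ω i}) = 2⁻¹ ^ n := by
    rw [Measure.infinitePi_pi _ (fun _ _ => measurableSet_singleton _)]
    have : ∀ b : Bool, (PMF.uniformOfFintype Bool).toMeasure {b} = 2⁻¹ := fun b => by
      rw [PMF.toMeasure_apply_singleton _ _ (measurableSet_singleton _)]; simp
    simp [this]
  rw [← h]
  refine measure_mono ?_
  rintro _ rfl i _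
  rfl

/-! ### Second moment method -/

/-- **Second moment method**: if the sum of the pairwise probabilities of the events `A i` exceeds
the square of the expected number `e` of events that occur by at most `C * e`, then the probability
that none occurs is at most `C / e`. -/
theorem measureReal_iInter_compl_mul_le {Ω ι : Type*} [MeasurableSpace Ω] (μ : Measure Ω)
    [IsProbabilityMeasure μ] (Q : Finset ι) (A : ι → Set Ω) (hA : ∀ i, MeasurableSet (A i)) (C : ℝ)
    (h : ∑ i ∈ Q, ∑ j ∈ Q, μ.real (A i ∩ A j) ≤
      (∑ i ∈ Q, μ.real (A i)) ^ 2 + C * ∑ i ∈ Q, μ.real (A i))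
    (hpos : 0 < ∑ i ∈ Q, μ.real (A i)) :
    μ.real (⋂ i ∈ Q, (A i)ᶜ) * (∑ i ∈ Q, μ.real (A i)) ≤ C := by
  set e := ∑ i ∈ Q, μ.real (A i) with he
  set B := ⋂ i ∈ Q, (A i)ᶜ with hB
  have hBm : MeasurableSet B := Finset.measurableSet_biInter _ fun i _ => (hA i).compl
  set Z : Ω → ℝ := fun x => ∑ i ∈ Q, (A i).indicator 1 x with hZ
  have hind : ∀ S : Set Ω, MeasurableSet S → Integrable (S.indicator (1 : Ω → ℝ)) μ := fun S hS =>
    (integrable_const (1 : ℝ)).indicator hS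
  have hZi : Integrable Z μ := integrable_finsetSum _ fun i _ => hind _ (hA i)
  have hZe : ∫ x, Z x ∂μ = e := by
    rw [hZ, integral_finsetSum _ fun i _ => hind _ (hA i)]
    exact Finset.sum_congr rfl fun i _ => integral_indicator_one (hA i)
  have hsq : (fun x => Z x ^ 2) =
      fun x => ∑ i ∈ Q, ∑ j ∈ Q, (A i ∩ A j).indicator (1 : Ω → ℝ) x := by
    funext x
    simp only [hZ, sq, Finset.sum_mul_sum, Set.inter_indicator_one, Pi.mul_apply]
  have hZ2i : Integrable (fun x => Z x ^ 2) μ := by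
    rw [hsq]
    exact integrable_finsetSum _ fun i _ => integrable_finsetSum _ fun j _ =>
      hind _ ((hA i).inter (hA j))
  have hZ2 : ∫ x, Z x ^ 2 ∂μ = ∑ i ∈ Q, ∑ j ∈ Q, μ.real (A i ∩ A j) := by
    rw [hsq, integral_finsetSum _ fun i _ => integrable_finsetSum _ fun j _ =>
      hind _ ((hA i).inter (hA j))]
    refine Finset.sum_congr rfl fun i _ => ?_
    rw [integral_finsetSum _ fun j _ => hind _ ((hA i).inter (hA j))]
    exact Finset.sum_congr rfl fun j _ => integral_indicator_one ((hA i).inter (hA j))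
  have hexp : (fun x => (Z x - e) ^ 2) = fun x => Z x ^ 2 - 2 * e * Z x + e ^ 2 := by
    funext x; ring
  have hsub : Integrable (fun x => Z x ^ 2 - 2 * e * Z x) μ := hZ2i.sub (hZi.const_mul _)
  have hvar : ∫ x, (Z x - e) ^ 2 ∂μ = ∫ x, Z x ^ 2 ∂μ - e ^ 2 := by
    rw [hexp, integral_add hsub (integrable_const _), integral_sub hZ2i (hZi.const_mul _),
      integral_const_mul, hZe, integral_const, probReal_univ, one_smul]
    ring
  have hvi : Integrable (fun x => (Z x - e) ^ 2) μ := by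
    rw [hexp]
    exact hsub.add (integrable_const _)
  -- Chebyshev: `Z` vanishes on `B`, so there `(Z - e) ^ 2 = e ^ 2`.
  have hlow : e ^ 2 * μ.real B ≤ ∫ x, (Z x - e) ^ 2 ∂μ := by
    rw [← integral_indicator_one hBm, ← integral_const_mul]
    refine integral_mono ((hind _ hBm).const_mul _) hvi fun x => ?_
    by_cases hx : x ∈ B
    · have hz : Z x = 0 := Finset.sum_eq_zero fun i hi =>
        Set.indicator_of_notMem (by simpa using Set.mem_iInter₂.1 hx i hi) _
      simp [hx, hz]
    · simp only [Set.indicator_of_notMem hx, mul_zero]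
      positivity
  have : e * (μ.real B * e) ≤ e * C := by nlinarith
  exact le_of_mul_le_mul_left this hpos

/-- The weight `2 ^ (p.1 - q.1)` of a pair of matches with equal shifts, where `p.1 ≤ q.1`. -/
noncomputable def overlapWeight (p q : ℕ × ℕ) : ℝ :=
  if p.1 + q.2 = q.1 + p.2 ∧ p.1 ≤ q.1 then (1 / 2) ^ (q.1 - p.1) else 0

theorem overlapWeight_nonneg (p q : ℕ × ℕ) : 0 ≤ overlapWeight p q := by
  unfold overlapWeight; split_ifs <;> positivity

/-- Once `q` and the common shift are fixed, `p` is determined by `q.1 - p.1`, so the sum is part of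
a geometric series. -/
theorem sum_overlapWeight_le (Q : Finset (ℕ × ℕ)) (q : ℕ × ℕ) :
    ∑ p ∈ Q, overlapWeight p q ≤ 2 := by
  simp only [overlapWeight]
  rw [← Finset.sum_filter]
  have hinj : Set.InjOn (fun p : ℕ × ℕ => q.1 - p.1)
      (Q.filter fun p => p.1 + q.2 = q.1 + p.2 ∧ p.1 ≤ q.1) := by
    rintro ⟨a, b⟩ h ⟨a', b'⟩ h' heq
    simp only [Finset.coe_filter, Set.mem_ofPred_eq] at h h' heq
    rw [Prod.mk.injEq]
    omega
  rw [← Finset.sum_image (f := fun k => (1 / 2 : ℝ) ^ k) hinj]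
  refine (summable_geometric_two.sum_le_tsum _ fun i _ => by positivity).trans ?_
  rw [tsum_geometric_two]

/-- The event attached to the pair `p = (n, m)`: the blocks of length `l n` at `n` and `m` agree. -/
def pairMatch (l : ℕ → ℕ) (p : ℕ × ℕ) : Set (ℕ → Bool) := blockMatch p.1 p.2 (l p.1)

theorem measureReal_pairMatch_inter_le_of_le {l : ℕ → ℕ} {p q : ℕ × ℕ}
    (hp : 2 * p.2 < p.1) (hq : 2 * q.2 < q.1) (hlp : 8 * l p.1 ≤ p.1) (hlq : 8 * l q.1 ≤ q.1)
    (hpq : p.1 ≤ q.1) :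
    coinMeasure.real (pairMatch l p ∩ pairMatch l q) ≤
      (1 / 2) ^ l p.1 * (1 / 2) ^ l q.1 + overlapWeight p q * (1 / 2) ^ l q.1 := by
  have hw : 0 ≤ overlapWeight p q * (1 / 2 : ℝ) ^ l q.1 :=
    mul_nonneg (overlapWeight_nonneg p q) (by positivity)
  unfold pairMatch
  by_cases hd : p.1 + l p.1 ≤ q.1
  · rw [measureReal_blockMatch_inter_of_disjoint (by omega) (by omega) hd]
    linarith
  by_cases hs : p.1 + q.2 = q.1 + p.2
  · refine (measureReal_blockMatch_inter_le (by omega) hpq (by omega) hs).trans ?_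
    rw [overlapWeight, if_pos ⟨hs, hpq⟩]
    have : (0 : ℝ) ≤ (1 / 2) ^ l p.1 * (1 / 2) ^ l q.1 := by positivity
    linarith
  -- Here `q.1 < p.1 + l p.1 ≤ 9/8 * p.1`, so the earlier block of `q` ends before `5/8 * q.1 <
  -- p.1`.
  · rw [measureReal_blockMatch_inter_of_ne (by omega) (by omega) (by omega) (by omega) (by omega)
      (by omega) hs]
    linarith

theorem measureReal_pairMatch_inter_le {l : ℕ → ℕ} {p q : ℕ × ℕ}
    (hp : 2 * p.2 < p.1) (hq : 2 * q.2 < q.1) (hlp : 8 * l p.1 ≤ p.1) (hlq : 8 * l q.1 ≤ q.1) :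
    coinMeasure.real (pairMatch l p ∩ pairMatch l q) ≤ (1 / 2) ^ l p.1 * (1 / 2) ^ l q.1 +
      (overlapWeight p q * (1 / 2) ^ l q.1 + overlapWeight q p * (1 / 2) ^ l p.1) := by
  have hw : 0 ≤ overlapWeight p q * (1 / 2 : ℝ) ^ l q.1 :=
    mul_nonneg (overlapWeight_nonneg p q) (by positivity)
  have hw' : 0 ≤ overlapWeight q p * (1 / 2 : ℝ) ^ l p.1 :=
    mul_nonneg (overlapWeight_nonneg q p) (by positivity)
  rcases le_total p.1 q.1 with h | h
  · linarith [measureReal_pairMatch_inter_le_of_le hp hq hlp hlq h]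
  · have := measureReal_pairMatch_inter_le_of_le hq hp hlq hlp h
    rw [Set.inter_comm]
    linarith

theorem measureReal_iInter_compl_pairMatch_mul_le {l : ℕ → ℕ} (Q : Finset (ℕ × ℕ))
    (hQ : ∀ p ∈ Q, 2 * p.2 < p.1 ∧ 8 * l p.1 ≤ p.1)
    (hpos : 0 < ∑ p ∈ Q, (1 / 2 : ℝ) ^ l p.1) :
    coinMeasure.real (⋂ p ∈ Q, (pairMatch l p)ᶜ) * ∑ p ∈ Q, (1 / 2 : ℝ) ^ l p.1 ≤ 4 := by
  have he : ∑ p ∈ Q, coinMeasure.real (pairMatch l p) = ∑ p ∈ Q, (1 / 2 : ℝ) ^ l p.1 :=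
    Finset.sum_congr rfl fun p hp => measureReal_blockMatch _ (by have := hQ p hp; omega)
  -- Used once for each order of the pair, whence the constant `4 = 2 + 2`.
  have hweight : ∑ q ∈ Q, ∑ p ∈ Q, overlapWeight p q * (1 / 2 : ℝ) ^ l q.1 ≤
      2 * ∑ q ∈ Q, (1 / 2 : ℝ) ^ l q.1 := by
    rw [Finset.mul_sum]
    refine Finset.sum_le_sum fun q _ => ?_
    rw [← Finset.sum_mul]
    exact mul_le_mul_of_nonneg_right (sum_overlapWeight_le Q q) (by positivity)
  rw [← he]
  refine measureReal_iInter_compl_mul_le _ Q (pairMatch l) (fun p => measurableSet_blockMatch _ _ _) 4 ?_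
    (he ▸ hpos)
  rw [he]
  calc ∑ p ∈ Q, ∑ q ∈ Q, coinMeasure.real (pairMatch l p ∩ pairMatch l q)
      ≤ ∑ p ∈ Q, ∑ q ∈ Q, ((1 / 2 : ℝ) ^ l p.1 * (1 / 2) ^ l q.1 +
          (overlapWeight p q * (1 / 2) ^ l q.1 + overlapWeight q p * (1 / 2) ^ l p.1)) :=
        Finset.sum_le_sum fun p hp => Finset.sum_le_sum fun q hq =>
          measureReal_pairMatch_inter_le (hQ p hp).1 (hQ q hq).1 (hQ p hp).2 (hQ q hq).2
    _ = (∑ p ∈ Q, (1 / 2 : ℝ) ^ l p.1) ^ 2 +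
          (∑ q ∈ Q, ∑ p ∈ Q, overlapWeight p q * (1 / 2 : ℝ) ^ l q.1 +
            ∑ p ∈ Q, ∑ q ∈ Q, overlapWeight q p * (1 / 2 : ℝ) ^ l p.1) := by
        simp only [Finset.sum_add_distrib]
        rw [sq, Finset.sum_mul_sum,
          Finset.sum_comm (f := fun p q => overlapWeight p q * (1 / 2 : ℝ) ^ l q.1)]
    _ ≤ _ := by linarith

/-- If `∑ n * 2 ^ (-l n)` diverges along the `n` with `8 * l n ≤ n`, then almost surely for
infinitely many such `n` the block of length `l n` at `n` has already occurred before `n / 2`. -/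
theorem ae_exists_blockMatch {l : ℕ → ℕ}
    (hdiv : ¬ Summable fun n : ℕ => if 8 * l n ≤ n then (n : ℝ) * (1 / 2) ^ l n else 0) :
    ∀ᵐ ω ∂coinMeasure, ∀ M, ∃ n ≥ M, ∃ m, 2 * m < n ∧ 8 * l n ≤ n ∧ ω ∈ blockMatch n m (l n) := by
  rw [ae_all_iff]
  intro M
  set B := {ω | ¬ ∃ n ≥ M, ∃ m, 2 * m < n ∧ 8 * l n ≤ n ∧ ω ∈ blockMatch n m (l n)} with hB
  change coinMeasure B = 0
  rw [← measureReal_eq_zero_iff]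
  set b : ℕ → ℝ := fun n => if 8 * l n ≤ n then (n : ℝ) * (1 / 2) ^ l n else 0 with hb
  have hb0 : ∀ n, 0 ≤ b n := fun n => by simp only [hb]; split_ifs <;> positivity
  have htend : Filter.Tendsto (fun N => ∑ n ∈ Finset.range N, b (n + M)) .atTop .atTop := by
    rw [← not_summable_iff_tendsto_nat_atTop_of_nonneg fun n => hb0 _]
    rwa [summable_nat_add_iff]
  have key : ∀ N, 0 < ∑ n ∈ Finset.range N, b (n + M) →
      coinMeasure.real B * ∑ n ∈ Finset.range N, b (n + M) ≤ 8 := by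
    intro N hN
    set T := ((Finset.range N).image (· + M)).filter (fun n => 8 * l n ≤ n) with hT
    -- Exactly `(n + 1) / 2 ≥ n / 2` naturals `m` satisfy `2 * m < n`; this costs a factor `2` and
    -- turns the bound `4` into `8`.
    set Q : Finset (ℕ × ℕ) := (T.sigma fun n => Finset.range ((n + 1) / 2)).map
      (Equiv.sigmaEquivProd ℕ ℕ).toEmbedding with hQdef
    have hQmem : ∀ p ∈ Q, p.1 ∈ T ∧ 2 * p.2 < p.1 := by
      intro p hp
      simp only [hQdef, Finset.mem_map, Finset.mem_sigma, Finset.mem_range] at hp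
      obtain ⟨⟨n, m⟩, ⟨h1, h2⟩, rfl⟩ := hp
      simp only at h1 h2
      exact ⟨h1, by simp only [Equiv.coe_toEmbedding, Equiv.sigmaEquivProd_apply]; omega⟩
    have hsum : ∑ n ∈ Finset.range N, b (n + M) ≤ 2 * ∑ p ∈ Q, (1 / 2 : ℝ) ^ l p.1 := by
      rw [hQdef, Finset.sum_map, Finset.sum_sigma, hT, Finset.sum_filter,
        Finset.sum_image (by intro a _ c _ h; simpa using h), Finset.mul_sum]
      refine Finset.sum_le_sum fun n _ => ?_
      simp only [hb, Equiv.coe_toEmbedding, Equiv.sigmaEquivProd_apply, Finset.sum_const,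
        Finset.card_range, nsmul_eq_mul]
      split_ifs
      · rw [← mul_assoc]
        gcongr
        have : n + M ≤ 2 * ((n + M + 1) / 2) := by omega
        exact_mod_cast this
      · simp
    have hle := measureReal_iInter_compl_pairMatch_mul_le (l := l) Q
      (fun p hp => ⟨(hQmem p hp).2, (Finset.mem_filter.1 (hQmem p hp).1).2⟩) (by linarith)
    have hsub : coinMeasure.real B ≤ coinMeasure.real (⋂ p ∈ Q, (pairMatch l p)ᶜ) := by
      refine measureReal_mono fun ω hω => ?_
      simp only [Set.mem_iInter, Set.mem_compl_iff]
      intro p hp hmem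
      obtain ⟨hpT, hp2⟩ := hQmem p hp
      rw [hT, Finset.mem_filter, Finset.mem_image] at hpT
      obtain ⟨⟨k, _, hk⟩, h8⟩ := hpT
      exact hω ⟨p.1, by omega, p.2, hp2, h8, hmem⟩
    have h0 : (0 : ℝ) ≤ ∑ p ∈ Q, (1 / 2 : ℝ) ^ l p.1 := by positivity
    have h1 := mul_le_mul_of_nonneg_right hsub h0
    have h2 := mul_le_mul_of_nonneg_left hsum (measureReal_nonneg (μ := coinMeasure) (s := B))
    linarith
  by_contra hne
  have hBpos : 0 < coinMeasure.real B := lt_of_le_of_ne measureReal_nonneg (Ne.symm hne)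
  obtain ⟨N, hN⟩ := (htend.eventually_gt_atTop (8 / coinMeasure.real B)).exists
  have hNpos := (div_pos (by norm_num : (0 : ℝ) < 8) hBpos).trans hN
  have := key N hNpos
  rw [div_lt_iff₀ hBpos] at hN
  linarith

/-! ### Rational points of the Cantor set from repeated blocks -/

theorem cantorPoint_mem_cantorSet (ω : ℕ → Bool) : cantorPoint ω ∈ cantorSet :=
  ofDigits_bool_to_fin_three_mem_cantorSet ω

theorem cantorPoint_injective : Function.Injective cantorPoint := by
  intro ω ω' h
  have h' := ofDigits_zero_two_sequence_unique (by grind) (by grind) h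
  funext n
  have := congrFun h' n
  cases h₁ : ω n <;> cases h₂ : ω' n <;> simp_all

theorem abs_cantorPoint_sub_le {ω ω' : ℕ → Bool} {n : ℕ} (h : ∀ i < n, ω i = ω' i) :
    |cantorPoint ω - cantorPoint ω'| ≤ ((3 : ℝ) ^ n)⁻¹ := by
  have := Real.abs_ofDigits_sub_ofDigits_le (b := 3) (x := fun n => bif ω n then 2 else 0)
    (y := fun n => bif ω' n then 2 else 0) (n := n) fun i hi => by rw [h i hi]
  exact_mod_cast this

theorem exists_pow_mul_cantorPoint (n : ℕ) (ω : ℕ → Bool) :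
    ∃ z : ℤ, (3 : ℝ) ^ n * cantorPoint ω = z + cantorPoint fun i => ω (i + n) := by
  induction n generalizing ω with
  | zero => exact ⟨0, by simp⟩
  | succ n ih =>
    obtain ⟨z, hz⟩ := ih fun i => ω (i + 1)
    refine ⟨3 ^ n * (bif ω 0 then 2 else 0) + z, ?_⟩
    have h1 : 3 * cantorPoint ω = (bif ω 0 then 2 else 0) + cantorPoint fun i => ω (i + 1) := by
      have := Real.ofDigits_eq_sum_add_ofDigits (b := 3) (fun n => bif ω n then 2 else 0) 1
      rw [cantorPoint, cantorPoint, this]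
      cases h : ω 0
      · simp [Real.ofDigitsTerm, h]
      · simp [Real.ofDigitsTerm, mul_add, h]
        norm_num
    have h2 : (fun i => ω (i + (n + 1))) = fun i => ω (i + n + 1) := rfl
    rw [pow_succ, mul_assoc, h1, mul_add, hz, h2]
    push_cast
    cases ω 0 <;> simp [add_assoc]

theorem exists_rat_eq_of_mul_eq_intCast {y : ℝ} {N : ℕ} {z : ℤ} (hN : 0 < N)
    (h : (N : ℝ) * y = z) : ∃ r : ℚ, (r : ℝ) = y ∧ r.den ≤ N := by
  refine ⟨(z : ℚ) / (N : ℤ), ?_, ?_⟩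
  · have : (N : ℝ) ≠ 0 := by positivity
    push_cast
    field_simp
    linarith
  · have := Rat.den_dvd z N
    exact Nat.le_of_dvd hN (by exact_mod_cast this)

/-- The sequence with the first `n` terms of `ω` that has period `n - m` from `m` on. -/
def periodize (m n : ℕ) (ω : ℕ → Bool) : ℕ → Bool :=
  fun k => if k < m then ω k else ω (m + (k - m) % (n - m))

/-- The digit tails from `m` and from `n` coincide, so `3 ^ n - 3 ^ m` times the point is an
integer. -/
theorem exists_rat_eq_cantorPoint_periodize {m n : ℕ} (h : m < n) (ω : ℕ → Bool) :
    ∃ r : ℚ, (r : ℝ) = cantorPoint (periodize m n ω) ∧ r.den ≤ 3 ^ n := by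
  obtain ⟨z, hz⟩ := exists_pow_mul_cantorPoint m (periodize m n ω)
  obtain ⟨w, hw⟩ := exists_pow_mul_cantorPoint n (periodize m n ω)
  have hper : (fun i => periodize m n ω (i + n)) = fun i => periodize m n ω (i + m) := by
    funext i
    have hin : i + n - m = i + (n - m) := by omega
    simp [periodize, hin, show ¬ i + n < m by omega]
  rw [hper] at hw
  have hlt : 3 ^ m < 3 ^ n := Nat.pow_lt_pow_right (by norm_num) h
  obtain ⟨r, hr, hden⟩ := exists_rat_eq_of_mul_eq_intCast (y := cantorPoint (periodize m n ω))
    (N := 3 ^ n - 3 ^ m) (z := w - z) (by omega) (by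
      rw [Nat.cast_sub hlt.le]
      push_cast
      linarith)
  exact ⟨r, hr, hden.trans (Nat.sub_le _ _)⟩

theorem periodize_eq_of_mem_blockMatch {m n l : ℕ} {ω : ℕ → Bool} (h : m + l ≤ n)
    (hω : ω ∈ blockMatch n m l) {i : ℕ} (hi : i < n + l) : ω i = periodize m n ω i := by
  unfold periodize
  split_ifs with him
  · rfl
  by_cases hin : i < n
  · rw [Nat.mod_eq_of_lt (by omega), Nat.add_sub_cancel' (by omega)]
  · have := mem_blockMatch.1 hω (i - n) (by omega)
    rw [Nat.add_sub_cancel' (by omega)] at this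
    rw [this, show i - m = i - n + (n - m) by omega, Nat.add_mod_right,
      Nat.mod_eq_of_lt (by omega)]

/-- Different `n` may yield the same rational; irrationality forces infinitely many distinct ones.
-/
theorem ae_cantorPoint_ne_rat : ∀ᵐ ω ∂coinMeasure, ∀ r : ℚ, cantorPoint ω ≠ r := by
  rw [ae_all_iff]
  intro r
  have hsub : {ω | ¬ cantorPoint ω ≠ r}.Subsingleton := fun ω hω ω' hω' =>
    cantorPoint_injective ((not_not.1 hω).trans (not_not.1 hω').symm)
  change coinMeasure {ω | ¬ cantorPoint ω ≠ r} = 0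
  rcases hsub.eq_empty_or_singleton with h | ⟨ω, h⟩
  · rw [h, measure_empty]
  · rw [h, coinMeasure_singleton]

/-- If `x` is irrational and the rational numbers with property `P` come arbitrarily close to it,
then there are infinitely many of them. -/
theorem infinite_rat_of_irrational {x : ℝ} {P : ℚ → Prop} (hx : ∀ r : ℚ, x ≠ r)
    (h : ∀ M : ℕ, ∃ r : ℚ, P r ∧ |x - r| ≤ ((3 : ℝ) ^ M)⁻¹) : {r : ℚ | P r}.Infinite := by
  intro hfin
  have hpos : ∀ r : ℚ, 0 < |x - r| := fun r => abs_pos.2 (sub_ne_zero.2 (hx r))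
  obtain ⟨ε, hε, hle⟩ : ∃ ε > 0, ∀ r ∈ {r : ℚ | P r}, ε ≤ |x - r| := by
    rcases Set.eq_empty_or_nonempty {r : ℚ | P r} with he | hne
    · exact ⟨1, one_pos, by simp [he]⟩
    · obtain ⟨r, -, hr⟩ := Set.exists_min_image _ (fun r : ℚ => |x - r|) hfin hne
      exact ⟨_, hpos r, hr⟩
  obtain ⟨M, hM⟩ := exists_pow_lt_of_lt_one hε (by norm_num : (3 : ℝ)⁻¹ < 1)
  obtain ⟨r, hr, hrM⟩ := h M
  rw [← inv_pow] at hrM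
  linarith [hle r hr]

/-! ### Block lengths and the divergence condition -/

theorem summable_mul_half_pow_of_lt {l : ℕ → ℕ} :
    Summable fun n : ℕ => if 8 * l n ≤ n then 0 else (n : ℝ) * (1 / 2) ^ l n := by
  -- If `n < 8 * l n` then `2 ^ (-l n) ≤ c ^ n`, so discarding these `n` costs only a convergent
  -- sum.
  set c : ℝ := (1 / 2 : ℝ) ^ (1 / 8 : ℝ) with hc
  have hc0 : 0 < c := by positivity
  have hc1 : c < 1 := Real.rpow_lt_one (by norm_num) (by norm_num) (by norm_num)
  have hc8 : c ^ 8 = 1 / 2 := by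
    rw [hc, ← Real.rpow_natCast, ← Real.rpow_mul (by norm_num)]; norm_num
  have hs := summable_pow_mul_geometric_of_norm_lt_one 1
    (show ‖c‖ < 1 by rwa [Real.norm_of_nonneg hc0.le])
  refine Summable.of_nonneg_of_le (fun n => ?_) (fun n => ?_) hs
  · split_ifs <;> positivity
  · split_ifs with h
    · positivity
    · rw [pow_one, ← hc8, ← pow_mul]
      exact mul_le_mul_of_nonneg_left (pow_le_pow_of_le_one hc0.le hc1.le (by omega))
        (Nat.cast_nonneg n)

theorem exists_inv_pow_lt {y : ℝ} (hy : 0 < y) (n : ℕ) : ∃ l : ℕ, ((3 : ℝ) ^ (n + l))⁻¹ < y := by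
  obtain ⟨M, hM⟩ := exists_pow_lt_of_lt_one hy (by norm_num : (3 : ℝ)⁻¹ < 1)
  refine ⟨M, lt_of_le_of_lt ?_ hM⟩
  rw [← inv_pow]
  exact pow_le_pow_of_le_one (by norm_num) (by norm_num) (by omega)

open Classical in
/-- The least number `l` of digits beyond the `n`-th that pin down a point up to less than `y`. -/
noncomputable def matchLength (y : ℝ) (n : ℕ) : ℕ :=
  -- The default `0` never occurs for `y > 0`.
  if h : ∃ l : ℕ, ((3 : ℝ) ^ (n + l))⁻¹ < y then Nat.find h else 0

theorem inv_pow_matchLength_lt {y : ℝ} (hy : 0 < y) (n : ℕ) :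
    ((3 : ℝ) ^ (n + matchLength y n))⁻¹ < y := by
  classical
  have h := exists_inv_pow_lt hy n
  rw [matchLength, dif_pos h]
  convert Nat.find_spec h

/-- By minimality one digit fewer fails, so `3 ^ n * y ≤ 3 ^ (-(l - 1))`, and the exponent `logb 3
2` turns `3` into `2`. -/
theorem rpow_le_two_mul_half_pow {y : ℝ} (hy : 0 < y) {n : ℕ} (h0 : matchLength y n ≠ 0) :
    ((3 : ℝ) ^ n * y) ^ Real.logb 3 2 ≤ 2 * (1 / 2) ^ matchLength y n := by
  classical
  have h := exists_inv_pow_lt hy n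
  obtain ⟨k, hk⟩ := Nat.exists_eq_succ_of_ne_zero h0
  have hle : y ≤ ((3 : ℝ) ^ (n + k))⁻¹ := by
    by_contra! hlt
    have : matchLength y n ≤ k := by
      rw [matchLength, dif_pos h]
      exact Nat.find_min' h hlt
    omega
  have hle' : (3 : ℝ) ^ n * y ≤ ((3 : ℝ) ^ k)⁻¹ := by
    calc (3 : ℝ) ^ n * y ≤ 3 ^ n * (3 ^ (n + k))⁻¹ := by gcongr
      _ = (3 ^ k)⁻¹ := by rw [pow_add]; field_simp
  have hlog : (0 : ℝ) ≤ Real.logb 3 2 := Real.logb_nonneg (by norm_num) (by norm_num)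
  calc ((3 : ℝ) ^ n * y) ^ Real.logb 3 2 ≤ ((3 ^ k)⁻¹ : ℝ) ^ Real.logb 3 2 :=
        Real.rpow_le_rpow (by positivity) hle' hlog
    _ = ((3 ^ Real.logb 3 2 : ℝ) ^ k)⁻¹ := by
        rw [Real.inv_rpow (by positivity), ← Real.rpow_natCast, ← Real.rpow_natCast,
          ← Real.rpow_mul (by norm_num), ← Real.rpow_mul (by norm_num), mul_comm]
    _ = 2 * (1 / 2) ^ matchLength y n := by
        rw [Real.rpow_logb (by norm_num) (by norm_num) (by norm_num), hk, Nat.succ_eq_add_one,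
          pow_succ, one_div, inv_pow]
        ring

theorem not_summable_matchLength {y : ℕ → ℝ} (hy : ∀ n, 0 < y n)
    (hdiv : ¬ Summable fun n : ℕ => (n : ℝ) * ((3 : ℝ) ^ n * y n) ^ Real.logb 3 2) :
    ¬ Summable fun n : ℕ => if 8 * matchLength (y n) n ≤ n then
      (n : ℝ) * (1 / 2) ^ matchLength (y n) n else 0 := by
  intro hs
  refine hdiv ?_
  have hsum := (hs.add (summable_mul_half_pow_of_lt (l := fun n => matchLength (y n) n))).mul_left 2
  refine hsum.of_norm_bounded_eventually_nat ?_
  -- A zero length would make the term equal to `n ≥ 1`, so convergence excludes it eventually.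
  have hsmall := hs.tendsto_atTop_zero.eventually_lt_const (one_pos)
  filter_upwards [hsmall, Filter.eventually_ge_atTop 1] with n hn hn1
  have h0 : matchLength (y n) n ≠ 0 := by
    intro h0
    simp only [h0, mul_zero, zero_le, if_true, pow_zero, mul_one] at hn
    have : (1 : ℝ) ≤ n := by exact_mod_cast hn1
    linarith
  have hyn := hy n
  rw [Real.norm_of_nonneg (by positivity)]
  have := mul_le_mul_of_nonneg_left (rpow_le_two_mul_half_pow hyn h0) (Nat.cast_nonneg (α := ℝ) n)
  refine this.trans (le_of_eq ?_)
  split_ifs <;> ring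

theorem mainTheorem2 (ψ : ℝ → ℝ)
    (hpos : ∀ t : ℝ, 0 < t → 0 < ψ t)
    (hanti : AntitoneOn ψ (Set.Ioi 0))
    (hdiv : ¬ Summable fun n : ℕ =>
      (n : ℝ) * ((3 : ℝ) ^ n * ψ ((3 : ℝ) ^ n)) ^ (Real.logb 3 2)) :
    cantorMeasure (intrinsicallyApproximable cantorSet ψ) = 1 := by
  have hy : ∀ n : ℕ, 0 < ψ ((3 : ℝ) ^ n) := fun n => hpos _ (by positivity)
  have hae : ∀ᵐ ω ∂coinMeasure, cantorPoint ω ∈ intrinsicallyApproximable cantorSet ψ := by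
    filter_upwards [ae_exists_blockMatch (not_summable_matchLength hy hdiv),
      ae_cantorPoint_ne_rat] with ω hω hirr
    refine ⟨cantorPoint_mem_cantorSet ω, infinite_rat_of_irrational hirr fun M => ?_⟩
    obtain ⟨n, hn, m, hm, hl, hmatch⟩ := hω M
    obtain ⟨r, hr, hden⟩ := exists_rat_eq_cantorPoint_periodize (show m < n by omega) ω
    have hclose := abs_cantorPoint_sub_le fun i =>
      periodize_eq_of_mem_blockMatch (by omega) hmatch (i := i)
    rw [← hr] at hclose
    refine ⟨r, ⟨hr ▸ cantorPoint_mem_cantorSet _, ?_⟩, hclose.trans ?_⟩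
    · refine hclose.trans_lt ((inv_pow_matchLength_lt (hy n) n).trans_le ?_)
      refine hanti (by simpa using r.pos) (by simp) ?_
      exact_mod_cast hden
    · gcongr
      · norm_num
      · omega
  refine le_antisymm prob_le_one ?_
  calc (1 : ENNReal) = coinMeasure (cantorPoint ⁻¹' intrinsicallyApproximable cantorSet ψ) :=
        measure_univ.symm.trans (measure_congr (Filter.eventuallyEq_univ.2 hae).symm)
    _ ≤ cantorMeasure (intrinsicallyApproximable cantorSet ψ) :=
        Measure.le_map_apply measurable_cantorPoint.aemeasurable _
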